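/- Consider the two-user bursty interference channel over $\mathbb F_2$ with direct gain $n_d\in\mathbb N$ and cross gain $n_c\in\mathbb N$, where $n_c\le 2n_d$ (that is, the interference is not very strong). Let $q=\max(n_d,n_c)$, and let $\mathsf S_u\in\mathbb F_2^{q\times q}$ be the down-shift matrix that moves the $u$ topmost components of a vector to its $u$ lowest positions and fills the rest with zeros. In coherence block $k=1,\dots,K$, of length $T\ge 1$, the inputs are $X_{1,k},X_{2,k}\in\mathbb F_2^{q\times T}$ and the outputs are $$Y_{1,k}=\mathsf S_{n_d}X_{1,k}\oplus B_{1,k}\mathsf S_{n_c}X_{2,k},\qquad Y_{2,k}=\mathsf S_{n_d}X_{2,k}\oplus B_{2,k}\mathsf S_{n_c}X_{1,k},$$ where $B_1^K=(B_{1,1},\dots,B_{1,K})$ and $B_2^K=(B_{2,1},\dots,B_{2,K})$ are sequences of i.i.d. Bernoulli variables with $\Pr\{B_{i,k}=1\}=p\in[0,1]$, independent of each other and of the messages. The messages $W_1,W_2$ are independent, $W_i$ being uniformly distributed over a set of $\lceil 2^{KTR_i}\rceil$ elements. Under local CSIR, encoder $i$ maps $W_i$ to $X_i^K$ (without knowledge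 of the states), and decoder $i$ maps $(Y_i^K,B_i^K)$ to $\hat W_i$. For fixed $T$, a pair $(R_1,R_2)$ with $R_1,R_2\ge 0$ is achievable if there is a sequence of such codes, indexed by $K$, with $\Pr\{\hat W_1\ne W_1\text{ or }\hat W_2\ne W_2\}\to 0$ as $K\to\infty$; the capacity region is the closure of the set of achievable pairs. Then, for every $T\ge 1$, the following sum rate $R$ is achievable, in the sense that $R=R_1+R_2$ for some $(R_1,R_2)$ in the capacity region: $$R=\begin{cases}2(1-2p)n_d+2p\bigl[(n_d-n_c)^++\max(n_d,n_c)\bigr], & p\le \tfrac12,\\[1ex] \min\Bigl\{(n_d-n_c)^++\max(n_d,n_c),\; 2(1-p)\bigl[(n_d-n_c)^++\max(n_d,n_c)\bigr]+2(2p-1)\max\{(n_d-n_c)^+,n_c\}\Bigr\}, & p>\tfrac12,\end{cases}$$ where $(x)^+=\max\{0,x\}$. -/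

import Mathlib

open Filter Topology

namespace BurstyIC

/-- The `q × q` down-shift matrix `S_u` over `𝔽₂` with blocks `[0 0; I_u 0]`: it moves the `u`
topmost components of a vector to its `u` lowest positions and puts zeros elsewhere
(used with `u ≤ q`). -/
def shift (q u : ℕ) : Matrix (Fin q) (Fin q) (ZMod 2) :=
  Matrix.of fun i j => if (i : ℕ) + u = (j : ℕ) + q then 1 else 0

/-- The number of signal levels `q = max (n_d, n_c)`. -/
abbrev levels (nd nc : ℕ) : ℕ := max nd nc

/-- A block of `T` channel symbols with `q` signal levels: an element of `𝔽₂^{q × T}`. -/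
abbrev Block (q T : ℕ) : Type := Matrix (Fin q) (Fin T) (ZMod 2)

/-- The output `S_{n_d} X ⊕ B S_{n_c} X'` at one receiver in one coherence block, where `X` is the
input of its own transmitter, `X'` the input of the interfering transmitter and `B` the
interference state (`true` if the interference is present). -/
def output (nd nc : ℕ) {T : ℕ} (B : Bool) (X X' : Block (levels nd nc) T) :
    Block (levels nd nc) T :=
  shift (levels nd nc) nd * X
    + (if B then (1 : ZMod 2) else 0) • (shift (levels nd nc) nc * X')

/-- A code over `K` coherence blocks of length `T` for local channel state information at the
receivers. The encoders know only their own message; decoder `i` knows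
its own channel output and its own state sequence in all `K` blocks. The message sets have `M₁`
and `M₂` elements. -/
structure Code (q T K M₁ M₂ : ℕ) where
  enc₁ : Fin M₁ → Fin K → Block q T
  enc₂ : Fin M₂ → Fin K → Block q T
  dec₁ : (Fin K → Block q T) → (Fin K → Bool) → Fin M₁
  dec₂ : (Fin K → Block q T) → (Fin K → Bool) → Fin M₂

/-- The probability of the state sequence `b` when the `K` states are i.i.d. Bernoulli with
activation probability `p`. -/
noncomputable def stateProb (p : ℝ) {K : ℕ} (b : Fin K → Bool) : ℝ :=
  ∏ k, if b k then p else 1 - p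

/-- The event that at least one of the receivers decodes its message wrongly, for messages
`w₁`, `w₂` and state sequences `b₁`, `b₂`. -/
def Code.Error (nd nc : ℕ) {T K M₁ M₂ : ℕ} (c : Code (levels nd nc) T K M₁ M₂)
    (w₁ : Fin M₁) (w₂ : Fin M₂) (b₁ b₂ : Fin K → Bool) : Prop :=
  c.dec₁ (fun k => output nd nc (b₁ k) (c.enc₁ w₁ k) (c.enc₂ w₂ k)) b₁ ≠ w₁ ∨
  c.dec₂ (fun k => output nd nc (b₂ k) (c.enc₂ w₂ k) (c.enc₁ w₁ k)) b₂ ≠ w₂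

open Classical in
/-- The error probability `Pr {Ŵ₁ ≠ W₁ ∪ Ŵ₂ ≠ W₂}` when `W₁, W₂, B₁^K, B₂^K` are independent,
`W₁` and `W₂` are uniformly distributed over the message sets, and `B₁^K` and `B₂^K` are
sequences of i.i.d. Bernoulli variables with activation probability `p`. -/
noncomputable def Code.errorProb (nd nc : ℕ) (p : ℝ) {T K M₁ M₂ : ℕ}
    (c : Code (levels nd nc) T K M₁ M₂) : ℝ :=
  ∑ w₁ : Fin M₁, ∑ w₂ : Fin M₂, ∑ b₁ : Fin K → Bool, ∑ b₂ : Fin K → Bool,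
    (1 / (M₁ : ℝ)) * (1 / (M₂ : ℝ)) * stateProb p b₁ * stateProb p b₂ *
      (if c.Error nd nc w₁ w₂ b₁ b₂ then 1 else 0)

/-- The number of messages `2^{K T R}` (rounded up to an integer) of a code of rate `R`. -/
noncomputable def numMessages (K T : ℕ) (R : ℝ) : ℕ := ⌈(2 : ℝ) ^ ((K : ℝ) * (T : ℝ) * R)⌉₊

/-- The rate pair `(R₁, R₂)` is achievable: there is a sequence, indexed by the number `K` of
coherence blocks, of codes of these rates whose error probability tends to zero. -/
def Achievable (nd nc T : ℕ) (p : ℝ) (R : ℝ × ℝ) : Prop :=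
  0 ≤ R.1 ∧ 0 ≤ R.2 ∧
    ∃ c : ∀ K : ℕ, Code (levels nd nc) T K (numMessages K T R.1) (numMessages K T R.2),
      Tendsto (fun K => (c K).errorProb nd nc p) atTop (𝓝 0)

/-- The capacity region: the closure of the set of achievable rate pairs. -/
def capacityRegion (nd nc T : ℕ) (p : ℝ) : Set (ℝ × ℝ) :=
  closure {R | Achievable nd nc T p R}

/-- The sum rate `R` is achieved: it is the sum `R₁ + R₂` of a rate pair in the capacity
region. -/
def SumRateAchievable (nd nc T : ℕ) (p R : ℝ) : Prop :=
  ∃ R₁ R₂ : ℝ, (R₁, R₂) ∈ capacityRegion nd nc T p ∧ R₁ + R₂ = R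

end BurstyIC

/-! Each user spreads its symbols over the signal levels so that some of them, the component in `C`,
survive every interference state, while the others, in `E`, need only survive when interference is
absent. Since a decoder knows its own states, each user sees at worst an erasure channel with known
erasure positions, of capacity `log |C| + (1 - p) log |E|` per block. `Resolves` expresses this
splitting, and `mem_capacityRegion_of_resolves` turns it into a rate pair by random coding with a
union bound (`sum_ambiguous_le`, `exists_exponent`).

What remains is combinatorial: choosing the levels. For `p ≤ 1/2`, and for very weak interference,
every level that reaches the own receiver carries a fresh symbol and interference counts as erasure.
For `p > 1/2` and moderate interference, an empty band protects the lowest levels of the other user.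
For stronger interference one user repeats symbols with period `|nd - nc|`; the other receiver reads
one period on rows free of its own signal and subtracts the interference, so nothing is erased and
the pair does not depend on `p`. -/

namespace BurstyIC

/-! ### Random coding for the erasure channel -/

/-- Two words over the alphabet `C × E` look the same when the second component is erased in the
positions where `b` is `true`. -/
def Confusable {C E : Type*} {K : ℕ} (b : Fin K → Bool) (a a' : Fin K → C × E) : Prop :=
  ∀ k, (a k).1 = (a' k).1 ∧ (b k = false → a k = a' k)

/-- The word of `w` is confusable with the word of another message. -/
def Ambiguous {C E : Type*} {K M : ℕ} (enc : Fin M → Fin K → C × E) (w : Fin M)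
    (b : Fin K → Bool) : Prop :=
  ∃ w', w' ≠ w ∧ Confusable b (enc w') (enc w)

open Classical in
/-- The probability that a uniformly distributed message is ambiguous. -/
noncomputable def ambiguityProb (p : ℝ) {C E : Type*} {K M : ℕ}
    (enc : Fin M → Fin K → C × E) : ℝ :=
  ∑ w : Fin M, ∑ b : Fin K → Bool,
    (1 / (M : ℝ)) * stateProb p b * (if Ambiguous enc w b then 1 else 0)

lemma stateProb_nonneg {p : ℝ} (hp0 : 0 ≤ p) (hp1 : p ≤ 1) {K : ℕ} (b : Fin K → Bool) :
    0 ≤ stateProb p b := by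
  refine Finset.prod_nonneg fun k _ => ?_
  split_ifs <;> linarith

lemma sum_stateProb_mul_prod (p : ℝ) {K : ℕ} (f : Bool → ℝ) :
    ∑ b : Fin K → Bool, stateProb p b * ∏ k, f (b k) = (p * f true + (1 - p) * f false) ^ K := by
  have h := Finset.prod_univ_sum (ι := Fin K) (fun _ => (Finset.univ : Finset Bool))
    (fun _ c => (if c then p else 1 - p) * f c)
  simp only [Fintype.piFinset_univ, Fintype.sum_bool, Finset.prod_const, Finset.card_univ,
    Fintype.card_fin] at h
  simp only [stateProb, ← Finset.prod_mul_distrib]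
  rw [← h]
  simp

lemma sum_stateProb (p : ℝ) {K : ℕ} : ∑ b : Fin K → Bool, stateProb p b = 1 := by
  simpa using sum_stateProb_mul_prod p (K := K) (fun _ => 1)

/-- Two distinct codewords of a uniformly random code are independent: once every coordinate except
`i` is fixed, the sum over `f i` is always `N`. -/
lemma sum_pi_pair {ι α : Type*} [Fintype ι] [DecidableEq ι] [Fintype α] {i j : ι} (hij : j ≠ i)
    (F : α → α → ℝ) (N : ℝ) (hN : ∀ a', ∑ a, F a a' = N) :
    ∑ f : ι → α, F (f i) (f j) = N * (Fintype.card α : ℝ) ^ (Fintype.card ι - 1) := by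
  rw [← (Equiv.funSplitAt i α).symm.sum_comp, Fintype.sum_prod_type, Finset.sum_comm]
  have : ∀ g : {j // j ≠ i} → α, ∀ a : α,
      F ((Equiv.funSplitAt i α).symm (a, g) i) ((Equiv.funSplitAt i α).symm (a, g) j)
        = F a (g ⟨j, hij⟩) := by
    intro g a
    simp [Equiv.funSplitAt, Equiv.piSplitAt, hij]
  simp only [this, hN]
  simp [Fintype.card_subtype_compl, mul_comm]

open Classical in
-- The confusable words form a product set, with the second component free exactly in the erased
-- positions.
lemma card_confusable {C E : Type*} [Fintype C] [Fintype E] {K : ℕ} (b : Fin K → Bool)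
    (a' : Fin K → C × E) :
    ∑ a : Fin K → C × E, (if Confusable b a a' then (1 : ℝ) else 0)
      = ∏ k, if b k then (Fintype.card E : ℝ) else 1 := by
  have h : (Finset.univ.filter fun a : Fin K → C × E => Confusable b a a')
      = Fintype.piFinset fun k =>
        if b k then ({(a' k).1} : Finset C) ×ˢ (Finset.univ : Finset E) else {a' k} := by
    ext a
    rw [Finset.mem_filter, Fintype.mem_piFinset, and_iff_right (Finset.mem_univ _)]
    refine forall_congr' fun k => ?_
    cases hb : b k
    · simp +contextual
    · simp [Prod.ext_iff, eq_comm]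
  rw [Finset.sum_boole, h, Fintype.card_piFinset]
  push_cast
  refine Finset.prod_congr rfl fun k _ => ?_
  split_ifs <;> simp

/-- Gallager's device: a union bound on a probability may be raised to a power `t ≤ 1`, because the
probability is at most one where the bound is trivial. -/
lemma le_rpow_of_le_one_of_le {x z t : ℝ} (ht0 : 0 ≤ t) (ht1 : t ≤ 1) (hz : 0 ≤ z) (h1 : x ≤ 1)
    (hx : x ≤ z) : x ≤ z ^ t := by
  rcases le_total 1 z with h | h
  · exact h1.trans (Real.one_le_rpow h ht0)
  · exact hx.trans (by simpa using Real.rpow_le_rpow_of_exponent_ge_of_imp hz h ht1 (by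
      intro _ h; simp_all))

open Classical in
/-- The average over all codes of the indicator of ambiguity. -/
lemma sum_ambiguous_le {C E : Type*} [Fintype C] [Fintype E] [Nonempty C] [Nonempty E]
    {K M : ℕ} (w : Fin M) (b : Fin K → Bool) {t : ℝ} (ht0 : 0 ≤ t) (ht1 : t ≤ 1) :
    (∑ enc : Fin M → Fin K → C × E, if Ambiguous enc w b then (1 : ℝ) else 0)
      ≤ Fintype.card (Fin M → Fin K → C × E) * (((M : ℝ) - 1) ^ t *
        ∏ k, (if b k then (Fintype.card C : ℝ)⁻¹
          else ((Fintype.card C : ℝ) * Fintype.card E)⁻¹) ^ t) := by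
  have hC : (0 : ℝ) < Fintype.card C := by exact_mod_cast Fintype.card_pos
  have hE : (0 : ℝ) < Fintype.card E := by exact_mod_cast Fintype.card_pos
  have hM : 1 ≤ M := w.pos
  have hM1 : (0 : ℝ) ≤ (M : ℝ) - 1 := by
    have : (1 : ℝ) ≤ M := by exact_mod_cast hM
    linarith
  set A : ℝ := (Fintype.card (Fin M → Fin K → C × E) : ℝ) with hA
  have hA0 : 0 < A := by rw [hA]; exact_mod_cast Fintype.card_pos
  set π : ℝ := ∏ k, (if b k then (Fintype.card C : ℝ)⁻¹
          else ((Fintype.card C : ℝ) * Fintype.card E)⁻¹) with hπ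
  have hterm : ∀ k, 0 ≤ (if b k then (Fintype.card C : ℝ)⁻¹
          else ((Fintype.card C : ℝ) * Fintype.card E)⁻¹) := by
    intro k; split_ifs <;> positivity
  have hπ0 : 0 ≤ π := Finset.prod_nonneg fun k _ => hterm k
  rw [Real.finsetProd_rpow _ _ (fun k _ => hterm k), ← hπ, ← Real.mul_rpow hM1 hπ0,
    ← div_le_iff₀' hA0]
  have hpair : ∀ w', w' ≠ w →
      ∑ enc : Fin M → Fin K → C × E, (if Confusable b (enc w') (enc w) then (1 : ℝ) else 0)
        = A * π := by
    intro w' hw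
    rw [sum_pi_pair hw.symm (fun a a' => if Confusable b a a' then (1 : ℝ) else 0) _
      (card_confusable b)]
    have hA' : A = (Fintype.card (Fin K → C × E) : ℝ)
        * (Fintype.card (Fin K → C × E) : ℝ) ^ (Fintype.card (Fin M) - 1) := by
      rw [← pow_succ', hA, Fintype.card_fun (α := Fin M), Fintype.card_fin, Nat.sub_add_cancel hM]
      push_cast
      rfl
    have hN : (∏ k, if b k then (Fintype.card E : ℝ) else 1)
        = (Fintype.card (Fin K → C × E) : ℝ) * π := by
      have : (Fintype.card (Fin K → C × E) : ℝ)
          = ∏ _k : Fin K, ((Fintype.card C : ℝ) * Fintype.card E) := by simp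
      rw [this, hπ, ← Finset.prod_mul_distrib]
      refine Finset.prod_congr rfl fun k _ => ?_
      split_ifs <;> field_simp
    rw [hN, hA']
    ring
  -- The ambiguity probability is at most one, and at most `(M - 1) * π` by the union bound over the
  -- rival messages.
  refine le_rpow_of_le_one_of_le ht0 ht1 (by positivity) ?_ ?_
  · rw [div_le_one hA0]
    refine (Finset.sum_le_card_nsmul _ _ 1 fun e _ => ?_).trans (by simp [hA])
    split_ifs <;> norm_num
  · rw [div_le_iff₀ hA0]
    calc (∑ enc : Fin M → Fin K → C × E, if Ambiguous enc w b then (1 : ℝ) else 0)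
        ≤ ∑ enc : Fin M → Fin K → C × E, ∑ w' ∈ Finset.univ.erase w,
            (if Confusable b (enc w') (enc w) then (1 : ℝ) else 0) := by
          refine Finset.sum_le_sum fun enc _ => ?_
          split_ifs with h
          · obtain ⟨w', hw', hc⟩ := h
            have := Finset.single_le_sum
              (f := fun w' => if Confusable b (enc w') (enc w) then (1 : ℝ) else 0)
              (s := Finset.univ.erase w) (fun i _ => by split_ifs <;> norm_num)
              (Finset.mem_erase.2 ⟨hw', Finset.mem_univ _⟩)
            simpa [hc] using this
          · exact Finset.sum_nonneg fun i _ => by split_ifs <;> norm_num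
      _ = ∑ w' ∈ Finset.univ.erase w, A * π := by
          rw [Finset.sum_comm]
          exact Finset.sum_congr rfl fun w' hw' => hpair w' (Finset.ne_of_mem_erase hw')
      _ = ((M : ℝ) - 1) * π * A := by
          rw [Finset.sum_const, Finset.card_erase_of_mem (Finset.mem_univ _), Finset.card_univ,
            Fintype.card_fin, nsmul_eq_mul, Nat.cast_sub hM]
          push_cast
          ring

/-- Random coding for the erasure channel. -/
lemma exists_ambiguityProb_le {p : ℝ} (hp0 : 0 ≤ p) (hp1 : p ≤ 1) (C E : Type*) [Fintype C]
    [Fintype E] [Nonempty C] [Nonempty E] (K : ℕ) {M : ℕ} (hM : 1 ≤ M) {t : ℝ} (ht0 : 0 ≤ t)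
    (ht1 : t ≤ 1) :
    ∃ enc : Fin M → Fin K → C × E, ambiguityProb p enc ≤ ((M : ℝ) - 1) ^ t *
      (p * (Fintype.card C : ℝ)⁻¹ ^ t
        + (1 - p) * ((Fintype.card C : ℝ) * Fintype.card E)⁻¹ ^ t) ^ K := by
  classical
  set r : ℝ := ((M : ℝ) - 1) ^ t * (p * (Fintype.card C : ℝ)⁻¹ ^ t
        + (1 - p) * ((Fintype.card C : ℝ) * Fintype.card E)⁻¹ ^ t) ^ K with hr
  suffices hsum : ∑ enc : Fin M → Fin K → C × E, ambiguityProb p enc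
      ≤ ∑ _enc : Fin M → Fin K → C × E, r by
    obtain ⟨enc, -, h⟩ := Finset.exists_le_of_sum_le Finset.univ_nonempty hsum
    exact ⟨enc, h⟩
  simp only [ambiguityProb]
  rw [Finset.sum_comm]
  have hM0 : (M : ℝ) ≠ 0 := by positivity
  have key : ∀ w : Fin M, ∑ enc : Fin M → Fin K → C × E, ∑ b : Fin K → Bool,
      (1 / (M : ℝ)) * stateProb p b * (if Ambiguous enc w b then 1 else 0)
      ≤ (1 / (M : ℝ)) * (Fintype.card (Fin M → Fin K → C × E) * r) := by
    intro w
    rw [Finset.sum_comm]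
    -- The states are independent, so averaging the product over them yields a `K`-th power.
    have h2 := sum_stateProb_mul_prod p (K := K) fun c => (if c then (Fintype.card C : ℝ)⁻¹
          else ((Fintype.card C : ℝ) * Fintype.card E)⁻¹) ^ t
    simp only [if_true, Bool.false_eq_true, if_false] at h2
    calc _ ≤ ∑ b : Fin K → Bool, (1 / (M : ℝ)) * stateProb p b *
          (Fintype.card (Fin M → Fin K → C × E) * (((M : ℝ) - 1) ^ t *
        ∏ k, (if b k then (Fintype.card C : ℝ)⁻¹
          else ((Fintype.card C : ℝ) * Fintype.card E)⁻¹) ^ t)) := by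
          refine Finset.sum_le_sum fun b _ => ?_
          rw [← Finset.mul_sum]
          exact mul_le_mul_of_nonneg_left (sum_ambiguous_le w b ht0 ht1)
            (mul_nonneg (by positivity) (stateProb_nonneg hp0 hp1 b))
      _ = _ := by
          rw [hr, ← h2, Finset.mul_sum, Finset.mul_sum, Finset.mul_sum]
          exact Finset.sum_congr rfl fun b _ => by ring
  refine (Finset.sum_le_sum fun w _ => key w).trans (le_of_eq ?_)
  simp only [Finset.sum_const, Finset.card_univ, Fintype.card_fin, nsmul_eq_mul]
  field_simp

/-- The base of the exponential error bound is below one for small `t` if the rate is below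
the capacity of the erasure channel. -/
lemma exists_exponent {p x y z : ℝ} (h : x < y + (1 - p) * z) :
    ∃ t : ℝ, 0 < t ∧ t ≤ 1 ∧
      Real.exp (x * t) * (p * Real.exp (-y * t) + (1 - p) * Real.exp (-(y + z) * t)) < 1 := by
  set f : ℝ → ℝ := fun t =>
    Real.exp (x * t) * (p * Real.exp (-y * t) + (1 - p) * Real.exp (-(y + z) * t)) with hf
  have hexp : ∀ c : ℝ, HasDerivAt (fun t : ℝ => Real.exp (c * t)) c 0 := by
    intro c
    simpa using ((hasDerivAt_id (0 : ℝ)).const_mul c).exp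
  -- As `f 0 = 1`, it suffices that the slope at zero, rate minus capacity, is negative.
  have hd : HasDerivAt f (x - (y + (1 - p) * z)) 0 := by
    have := (hexp x).mul (((hexp (-y)).const_mul p).add ((hexp (-(y + z))).const_mul (1 - p)))
    refine this.congr_deriv ?_
    simp
    ring
  have hneg : x - (y + (1 - p) * z) < 0 := by linarith
  have hlt := (hasDerivAt_iff_tendsto_slope.1 hd).eventually (gt_mem_nhds hneg)
  have hlt' : ∀ᶠ t in 𝓝[>] (0 : ℝ), slope f 0 t < 0 :=
    hlt.filter_mono (nhdsWithin_mono _ fun t (ht : 0 < t) => ht.ne')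
  have h1 : ∀ᶠ t in 𝓝[>] (0 : ℝ), t ≤ 1 :=
    (Iic_mem_nhds one_pos : Set.Iic (1 : ℝ) ∈ 𝓝 0) |> fun h => mem_nhdsWithin_of_mem_nhds h
  obtain ⟨t, ⟨ht, ht1⟩, ht0⟩ := ((hlt'.and h1).and self_mem_nhdsWithin).exists
  refine ⟨t, ht0, ht1, ?_⟩
  have ht0' : (0 : ℝ) < t := ht0
  have h0 : f 0 = 1 := by simp [hf]
  rw [slope_def_field, h0, sub_zero, div_neg_iff] at ht
  change f t < 1
  rcases ht with h | h <;> linarith [h.1, h.2]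

/-! ### From signalling maps to rate pairs -/

/-- The output of the receiver of the signalling map `f`, interfered by `g`, determines the symbol
of `f` up to the erasure of its second component when the interference is present. -/
def Resolves (nd nc : ℕ) {T : ℕ} {A C E : Type*} (f : C × E → Block (levels nd nc) T)
    (g : A → Block (levels nd nc) T) : Prop :=
  ∀ B x x' y y', output nd nc B (f x) (g y) = output nd nc B (f x') (g y') →
    x.1 = x'.1 ∧ (B = false → x = x')

/-- The decoder picks any message that explains the output for some interfering message. The true
message is one such, so a wrong choice yields the same output and is confusable with the truth,
block by block. -/
lemma Resolves.exists_decoder {nd nc T K M₁ M₂ : ℕ} {A C E : Type*}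
    {f : C × E → Block (levels nd nc) T} {g : A → Block (levels nd nc) T}
    (h : Resolves nd nc f g) (hM : 1 ≤ M₁) (enc₁ : Fin M₁ → Fin K → C × E)
    (enc₂ : Fin M₂ → Fin K → A) :
    ∃ dec : (Fin K → Block (levels nd nc) T) → (Fin K → Bool) → Fin M₁, ∀ w₁ w₂ b,
      dec (fun k => output nd nc (b k) (f (enc₁ w₁ k)) (g (enc₂ w₂ k))) b ≠ w₁ →
        Ambiguous enc₁ w₁ b := by
  have : ∀ (Y : Fin K → Block (levels nd nc) T) (b : Fin K → Bool), ∃ w : Fin M₁,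
      (∃ w₁ w₂, (fun k => output nd nc (b k) (f (enc₁ w₁ k)) (g (enc₂ w₂ k))) = Y) →
        ∃ w₂, (fun k => output nd nc (b k) (f (enc₁ w k)) (g (enc₂ w₂ k))) = Y := by
    intro Y b
    by_cases hY : ∃ w₁ w₂, (fun k => output nd nc (b k) (f (enc₁ w₁ k)) (g (enc₂ w₂ k))) = Y
    · exact ⟨hY.choose, fun _ => hY.choose_spec⟩
    -- Outputs that never occur are decoded arbitrarily.
    · exact ⟨⟨0, hM⟩, fun h => absurd h hY⟩
  choose dec hdec using this
  refine ⟨dec, fun w₁ w₂ b hne => ⟨_, hne, fun k => ?_⟩⟩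
  obtain ⟨w₂', hw⟩ := hdec (fun k => output nd nc (b k) (f (enc₁ w₁ k)) (g (enc₂ w₂ k))) b
    ⟨w₁, w₂, rfl⟩
  exact h _ _ _ _ _ (congrFun hw k)

/-- An error at a receiver forces ambiguity of its own message, an event depending only on that
message and that receiver's states. The remaining variables average out, and the union bound adds
the two users. -/
lemma exists_code_errorProb_le {nd nc T K M₁ M₂ : ℕ} {C₁ E₁ C₂ E₂ : Type*} {p : ℝ}
    (hp0 : 0 ≤ p) (hp1 : p ≤ 1)
    {f₁ : C₁ × E₁ → Block (levels nd nc) T} {f₂ : C₂ × E₂ → Block (levels nd nc) T}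
    (h₁ : Resolves nd nc f₁ f₂) (h₂ : Resolves nd nc f₂ f₁) (hM₁ : 1 ≤ M₁) (hM₂ : 1 ≤ M₂)
    (enc₁ : Fin M₁ → Fin K → C₁ × E₁) (enc₂ : Fin M₂ → Fin K → C₂ × E₂) :
    ∃ c : Code (levels nd nc) T K M₁ M₂,
      c.errorProb nd nc p ≤ ambiguityProb p enc₁ + ambiguityProb p enc₂ := by
  classical
  obtain ⟨dec₁, hd₁⟩ := h₁.exists_decoder hM₁ enc₁ enc₂
  obtain ⟨dec₂, hd₂⟩ := h₂.exists_decoder hM₂ enc₂ enc₁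
  refine ⟨⟨fun w k => f₁ (enc₁ w k), fun w k => f₂ (enc₂ w k), dec₁, dec₂⟩, ?_⟩
  have hM₁0 : (M₁ : ℝ) ≠ 0 := by positivity
  have hM₂0 : (M₂ : ℝ) ≠ 0 := by positivity
  have e₁ : ambiguityProb p enc₁ = ∑ w₁ : Fin M₁, ∑ _w₂ : Fin M₂, ∑ b₁ : Fin K → Bool,
      ∑ b₂ : Fin K → Bool, (1 / (M₁ : ℝ)) * (1 / (M₂ : ℝ)) * stateProb p b₁ * stateProb p b₂ *
      (if Ambiguous enc₁ w₁ b₁ then 1 else 0) := by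
    refine Finset.sum_congr rfl fun w₁ _ => ?_
    rw [Finset.sum_const, Finset.card_univ, Fintype.card_fin, nsmul_eq_mul, Finset.mul_sum]
    refine Finset.sum_congr rfl fun b₁ _ => ?_
    rw [← Finset.sum_mul, ← Finset.mul_sum, sum_stateProb]
    field_simp
  have e₂ : ambiguityProb p enc₂ = ∑ _w₁ : Fin M₁, ∑ w₂ : Fin M₂, ∑ b₁ : Fin K → Bool,
      ∑ b₂ : Fin K → Bool, (1 / (M₁ : ℝ)) * (1 / (M₂ : ℝ)) * stateProb p b₁ * stateProb p b₂ *
      (if Ambiguous enc₂ w₂ b₂ then 1 else 0) := by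
    rw [Finset.sum_const, Finset.card_univ, Fintype.card_fin, nsmul_eq_mul, Finset.mul_sum]
    refine Finset.sum_congr rfl fun w₂ _ => ?_
    rw [Finset.sum_comm, Finset.mul_sum]
    refine Finset.sum_congr rfl fun b₂ _ => ?_
    rw [← Finset.sum_mul, ← Finset.sum_mul, ← Finset.mul_sum, sum_stateProb]
    field_simp
  rw [e₁, e₂]
  simp only [← Finset.sum_add_distrib, Code.errorProb]
  refine Finset.sum_le_sum fun w₁ _ => Finset.sum_le_sum fun w₂ _ =>
    Finset.sum_le_sum fun b₁ _ => Finset.sum_le_sum fun b₂ _ => ?_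
  rw [← mul_add]
  refine mul_le_mul_of_nonneg_left ?_ (mul_nonneg (mul_nonneg (by positivity)
    (stateProb_nonneg hp0 hp1 _)) (stateProb_nonneg hp0 hp1 _))
  split_ifs with herr a₁ a₂ a₂ <;> norm_num
  rcases herr with herr | herr
  · exact a₁ (hd₁ _ _ _ herr)
  · exact a₂ (hd₂ _ _ _ herr)

lemma one_le_numMessages (K T : ℕ) (R : ℝ) : 1 ≤ numMessages K T R :=
  Nat.ceil_pos.2 (by positivity)

lemma ambiguityProb_nonneg {p : ℝ} (hp0 : 0 ≤ p) (hp1 : p ≤ 1) {C E : Type*} {K M : ℕ}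
    (enc : Fin M → Fin K → C × E) : 0 ≤ ambiguityProb p enc := by
  refine Finset.sum_nonneg fun w _ => Finset.sum_nonneg fun b _ =>
    mul_nonneg (mul_nonneg (by positivity) (stateProb_nonneg hp0 hp1 _)) ?_
  split_ifs <;> norm_num

lemma exists_tendsto_ambiguityProb {p : ℝ} (hp0 : 0 ≤ p) (hp1 : p ≤ 1) (C E : Type*) [Fintype C]
    [Fintype E] [Nonempty C] [Nonempty E] (T : ℕ) {R : ℝ}
    (hR : R = 0 ∨ T * R * Real.log 2
      < Real.log (Fintype.card C) + (1 - p) * Real.log (Fintype.card E)) :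
    ∃ enc : ∀ K : ℕ, Fin (numMessages K T R) → Fin K → C × E,
      Tendsto (fun K => ambiguityProb p (enc K)) atTop (𝓝 0) := by
  rcases hR with rfl | hR
  · have h1 : ∀ K, numMessages K T 0 = 1 := fun K => by simp [numMessages]
    -- With a single message the factor `(M - 1) ^ t` is `0 ^ 1 = 0`; the exponent `t = 1` avoids `0
    -- ^ 0`.
    choose enc henc using fun K => exists_ambiguityProb_le hp0 hp1 C E K
      (one_le_numMessages K T 0) zero_le_one le_rfl
    refine ⟨enc, tendsto_const_nhds.congr fun K => ?_⟩
    refine le_antisymm (ambiguityProb_nonneg hp0 hp1 _) ((henc K).trans ?_)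
    simp [h1]
  · obtain ⟨t, ht0, ht1, ht⟩ := exists_exponent hR
    choose enc henc using fun K => exists_ambiguityProb_le hp0 hp1 C E K
      (one_le_numMessages K T R) ht0.le ht1
    refine ⟨enc, squeeze_zero (fun K => ambiguityProb_nonneg hp0 hp1 _) (fun K => ?_)
      (tendsto_pow_atTop_nhds_zero_of_lt_one ?_ ht)⟩
    · have hC : (0 : ℝ) < Fintype.card C := by exact_mod_cast Fintype.card_pos
      have hE : (0 : ℝ) < Fintype.card E := by exact_mod_cast Fintype.card_pos
      have hinv : ∀ a : ℝ, 0 < a → a⁻¹ ^ t = Real.exp (-Real.log a * t) := by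
        intro a ha
        rw [Real.rpow_def_of_pos (inv_pos.2 ha), Real.log_inv]
      refine (henc K).trans ?_
      rw [hinv _ hC, hinv _ (mul_pos hC hE), Real.log_mul hC.ne' hE.ne', mul_pow]
      refine mul_le_mul_of_nonneg_right ?_ (pow_nonneg (add_nonneg
        (mul_nonneg hp0 (Real.exp_pos _).le)
        (mul_nonneg (by linarith) (Real.exp_pos _).le)) _)
      -- Counting only the `M - 1` rivals absorbs the rounding up.
      have hM : (numMessages K T R : ℝ) - 1 ≤ (2 : ℝ) ^ ((K : ℝ) * T * R) := by
        have := Nat.ceil_lt_add_one (a := (2 : ℝ) ^ ((K : ℝ) * T * R)) (by positivity)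
        rw [numMessages]
        linarith
      have hM0 : (0 : ℝ) ≤ (numMessages K T R : ℝ) - 1 := by
        have : (1 : ℝ) ≤ numMessages K T R := by exact_mod_cast one_le_numMessages K T R
        linarith
      refine (Real.rpow_le_rpow hM0 hM ht0.le).trans (le_of_eq ?_)
      rw [← Real.exp_nat_mul, Real.rpow_def_of_pos two_pos, ← Real.exp_mul]
      congr 1
      ring
    · exact mul_nonneg (Real.exp_pos _).le (add_nonneg
        (mul_nonneg hp0 (Real.exp_pos _).le)
        (mul_nonneg (by linarith) (Real.exp_pos _).le))

lemma achievable_of_resolves {nd nc T : ℕ} {p : ℝ} (hp0 : 0 ≤ p) (hp1 : p ≤ 1)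
    {C₁ E₁ C₂ E₂ : Type*} [Fintype C₁] [Fintype E₁] [Nonempty C₁] [Nonempty E₁]
    [Fintype C₂] [Fintype E₂] [Nonempty C₂] [Nonempty E₂]
    {f₁ : C₁ × E₁ → Block (levels nd nc) T} {f₂ : C₂ × E₂ → Block (levels nd nc) T}
    (h₁ : Resolves nd nc f₁ f₂) (h₂ : Resolves nd nc f₂ f₁) {R₁ R₂ : ℝ}
    (hR₁0 : 0 ≤ R₁) (hR₂0 : 0 ≤ R₂)
    (hR₁ : R₁ = 0 ∨ T * R₁ * Real.log 2
      < Real.log (Fintype.card C₁) + (1 - p) * Real.log (Fintype.card E₁))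
    (hR₂ : R₂ = 0 ∨ T * R₂ * Real.log 2
      < Real.log (Fintype.card C₂) + (1 - p) * Real.log (Fintype.card E₂)) :
    Achievable nd nc T p (R₁, R₂) := by
  obtain ⟨enc₁, ht₁⟩ := exists_tendsto_ambiguityProb hp0 hp1 C₁ E₁ T hR₁
  obtain ⟨enc₂, ht₂⟩ := exists_tendsto_ambiguityProb hp0 hp1 C₂ E₂ T hR₂
  choose c hc using fun K => exists_code_errorProb_le hp0 hp1 h₁ h₂
    (one_le_numMessages K T R₁) (one_le_numMessages K T R₂) (enc₁ K) (enc₂ K)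
  refine ⟨hR₁0, hR₂0, c, squeeze_zero (fun K => ?_) hc (by simpa using ht₁.add ht₂)⟩
  refine Finset.sum_nonneg fun _ _ => Finset.sum_nonneg fun _ _ => Finset.sum_nonneg fun _ _ =>
    Finset.sum_nonneg fun _ _ => mul_nonneg (mul_nonneg (mul_nonneg (by positivity)
    (stateProb_nonneg hp0 hp1 _)) (stateProb_nonneg hp0 hp1 _)) ?_
  split_ifs <;> norm_num

/-- If `cᵢ` levels of user `i` are always resolved and `eᵢ` levels are resolved unless there is
interference, then user `i` has rate `cᵢ + (1 - p) eᵢ`. -/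
lemma mem_capacityRegion_of_resolves {nd nc T : ℕ} (hT : 1 ≤ T) {p : ℝ} (hp0 : 0 ≤ p)
    (hp1 : p ≤ 1) {c₁ e₁ c₂ e₂ : ℕ}
    {f₁ : (Fin c₁ → Fin T → ZMod 2) × (Fin e₁ → Fin T → ZMod 2) → Block (levels nd nc) T}
    {f₂ : (Fin c₂ → Fin T → ZMod 2) × (Fin e₂ → Fin T → ZMod 2) → Block (levels nd nc) T}
    (h₁ : Resolves nd nc f₁ f₂) (h₂ : Resolves nd nc f₂ f₁) :
    ((c₁ : ℝ) + (1 - p) * e₁, (c₂ : ℝ) + (1 - p) * e₂) ∈ capacityRegion nd nc T p := by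
  set r₁ : ℝ := (c₁ : ℝ) + (1 - p) * e₁ with hr₁
  set r₂ : ℝ := (c₂ : ℝ) + (1 - p) * e₂ with hr₂
  have hq : 0 ≤ 1 - p := by linarith
  have h₁0 : 0 ≤ r₁ := by positivity
  have h₂0 : 0 ≤ r₂ := by positivity
  have hrate : ∀ (c e : ℕ) (s r : ℝ), s < 1 → 0 ≤ r → r = (c : ℝ) + (1 - p) * e →
      s * r = 0 ∨ T * (s * r) * Real.log 2
        < Real.log (Fintype.card (Fin c → Fin T → ZMod 2))
          + (1 - p) * Real.log (Fintype.card (Fin e → Fin T → ZMod 2)) := by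
    intro c e s r hs hr hre
    rcases hr.eq_or_lt with hr | hr
    -- A zero rate cannot be scaled strictly below itself, hence the separate alternative.
    · left; rw [← hr, mul_zero]
    · right
      have hl : 0 < Real.log 2 := Real.log_pos one_lt_two
      have hT' : (0 : ℝ) < T := by exact_mod_cast hT
      have hcard : ∀ a : ℕ, Real.log (Fintype.card (Fin a → Fin T → ZMod 2))
          = a * T * Real.log 2 := by
        intro a
        simp [ZMod.card, mul_assoc]
      rw [hcard, hcard]
      have : s * r < r := by nlinarith
      calc T * (s * r) * Real.log 2 < T * r * Real.log 2 := by gcongr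
        _ = _ := by rw [hre]; ring
  -- The closure allows an approach through rates strictly below capacity.
  have hs : Tendsto (fun n : ℕ => 1 - 1 / ((n : ℝ) + 1)) atTop (𝓝 1) := by
    simpa using tendsto_one_div_add_atTop_nhds_zero_nat.const_sub (1 : ℝ)
  have hlim : Tendsto (fun n : ℕ => ((1 - 1 / ((n : ℝ) + 1)) * r₁, (1 - 1 / ((n : ℝ) + 1)) * r₂))
      atTop (𝓝 (r₁, r₂)) := by
    simpa using (hs.mul_const r₁).prodMk_nhds (hs.mul_const r₂)
  refine mem_closure_of_tendsto hlim (Eventually.of_forall fun n => ?_)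
  have hpos : (0 : ℝ) < 1 / ((n : ℝ) + 1) := by positivity
  have hle : 1 / ((n : ℝ) + 1) ≤ 1 := by
    rw [div_le_one (by positivity)]
    linarith [(Nat.cast_nonneg n : (0 : ℝ) ≤ n)]
  exact achievable_of_resolves hp0 hp1 h₁ h₂ (mul_nonneg (by linarith) h₁0)
    (mul_nonneg (by linarith) h₂0) (hrate _ _ _ _ (by linarith) h₁0 hr₁)
    (hrate _ _ _ _ (by linarith) h₂0 hr₂)

/-! ### The channel level by level -/

/-- The block whose row on level `j` is `f j`; level `0` is the topmost one. -/
def ofLevels (q : ℕ) {T : ℕ} (f : ℕ → Fin T → ZMod 2) : Block q T :=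
  Matrix.of fun j t => f j t

lemma shift_mul_ofLevels {q u T : ℕ} (hu : u ≤ q) (f : ℕ → Fin T → ZMod 2) (j : Fin q) :
    (shift q u * ofLevels q f) j = if q ≤ j + u then f (j + u - q) else 0 := by
  ext t
  rw [Matrix.mul_apply]
  simp only [shift, ofLevels, Matrix.of_apply, ite_mul, one_mul, zero_mul]
  split_ifs with h
  · have hj := j.isLt
    rw [Finset.sum_eq_single (⟨j + u - q, by omega⟩ : Fin q)]
    · rw [if_pos (by simp only; omega)]
    · intro i _ hi
      rw [if_neg]
      intro h'
      exact hi (Fin.ext (by simp only; omega))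
    · simp
  · refine Finset.sum_eq_zero fun i _ => ?_
    rw [if_neg (by omega)]

lemma output_ofLevels {nd nc T : ℕ} (B : Bool) (f g : ℕ → Fin T → ZMod 2)
    (j : Fin (levels nd nc)) :
    output nd nc B (ofLevels _ f) (ofLevels _ g) j
      = (if levels nd nc ≤ j + nd then f (j + nd - levels nd nc) else 0)
        + if B then (if levels nd nc ≤ j + nc then g (j + nc - levels nd nc) else 0) else 0 := by
  rw [← shift_mul_ofLevels (le_max_left nd nc), ← shift_mul_ofLevels (le_max_right nd nc)]
  cases B <;> ext t <;> simp [output]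

/-- The own signal fills all `nd` rows, and the `nc` topmost levels of the interferer land on the
`nc` lowest rows, leaving the top `nd - nc` rows clean. -/
lemma resolves_of_le {nd nc T : ℕ} (hle : nc ≤ nd) {A C E : Type*}
    {F : C × E → ℕ → Fin T → ZMod 2} {G : A → ℕ → Fin T → ZMod 2}
    (h₀ : ∀ x x', (∀ j < nd, F x j = F x' j) → x = x')
    (h₁ : ∀ x x' y y', (∀ j < nd - nc, F x j = F x' j) →
      (∀ j < nc, F x (j + (nd - nc)) + G y j = F x' (j + (nd - nc)) + G y' j) → x.1 = x'.1) :
    Resolves nd nc (fun x => ofLevels _ (F x)) (fun y => ofLevels _ (G y)) := by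
  intro B x x' y y' h
  have hq : levels nd nc = nd := max_eq_left hle
  have hrow : ∀ j < nd, F x j + (if B then (if nd ≤ j + nc then G y (j + nc - nd) else 0) else 0)
      = F x' j + (if B then (if nd ≤ j + nc then G y' (j + nc - nd) else 0) else 0) := by
    intro j hj
    have := congrFun h ⟨j, hq.symm ▸ hj⟩
    rw [output_ofLevels, output_ofLevels] at this
    simpa [hq] using this
  cases B
  · have : x = x' := h₀ _ _ (by simpa using hrow)
    exact ⟨congrArg _ this, fun _ => this⟩
  · refine ⟨h₁ x x' y y' (fun j hj => ?_) (fun j hj => ?_), by simp⟩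
    · have := hrow j (by omega)
      rwa [if_pos rfl, if_pos rfl, if_neg (by omega), if_neg (by omega), add_zero,
        add_zero] at this
    · have := hrow (j + (nd - nc)) (by omega)
      rwa [if_pos rfl, if_pos rfl, if_pos (by omega), if_pos (by omega),
        show j + (nd - nc) + nc - nd = j by omega] at this

/-- The own signal arrives `nc - nd` rows lower than the interference, so the top `nc - nd` rows
show the interferer alone whenever it is active. -/
lemma resolves_of_lt {nd nc T : ℕ} (hlt : nd < nc) {A C E : Type*}
    {F : C × E → ℕ → Fin T → ZMod 2} {G : A → ℕ → Fin T → ZMod 2}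
    (h₀ : ∀ x x', (∀ j < nd, F x j = F x' j) → x = x')
    (h₁ : ∀ x x' y y', (∀ j < nc - nd, G y j = G y' j) →
      (∀ j < nd, F x j + G y (j + (nc - nd)) = F x' j + G y' (j + (nc - nd))) → x.1 = x'.1) :
    Resolves nd nc (fun x => ofLevels _ (F x)) (fun y => ofLevels _ (G y)) := by
  intro B x x' y y' h
  have hq : levels nd nc = nc := max_eq_right hlt.le
  have hrow : ∀ j < nc, (if nc ≤ j + nd then F x (j + nd - nc) else 0) + (if B then G y j else 0)
      = (if nc ≤ j + nd then F x' (j + nd - nc) else 0) + (if B then G y' j else 0) := by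
    intro j hj
    have := congrFun h ⟨j, hq.symm ▸ hj⟩
    rw [output_ofLevels, output_ofLevels] at this
    simpa [hq] using this
  cases B
  · have : x = x' := h₀ _ _ fun j hj => by
      have := hrow (j + (nc - nd)) (by omega)
      rw [show j + (nc - nd) + nd - nc = j by omega] at this
      simpa [show nc ≤ j + (nc - nd) + nd by omega] using this
    exact ⟨congrArg _ this, fun _ => this⟩
  · refine ⟨h₁ x x' y y' (fun j hj => ?_) (fun j hj => ?_), by simp⟩
    · simpa [show ¬ nc ≤ j + nd by omega] using hrow j (by omega)
    · have := hrow (j + (nc - nd)) (by omega)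
      rw [show j + (nc - nd) + nd - nc = j by omega] at this
      simpa [show nc ≤ j + (nc - nd) + nd by omega] using this

/-- The `j`-th entry of a tuple, continued by zero. -/
def entry {c : ℕ} {S : Type*} [Zero S] (x : Fin c → S) (j : ℕ) : S :=
  if h : j < c then x ⟨j, h⟩ else 0

lemma entry_of_le {c : ℕ} {S : Type*} [Zero S] (x : Fin c → S) {j : ℕ} (h : c ≤ j) :
    entry x j = 0 := dif_neg (by omega)

lemma ext_entry {c : ℕ} {S : Type*} [Zero S] {x x' : Fin c → S}
    (h : ∀ j < c, entry x j = entry x' j) : x = x' := by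
  ext ⟨j, hj⟩
  simpa [entry, hj] using h j hj

/-- This lets a signal of period `d` be recovered from any `d` consecutive levels. -/
lemma exists_mod_eq_of_window {d i : ℕ} (hi : i < d) (a : ℕ) :
    ∃ j, a ≤ j ∧ j < a + d ∧ j % d = i := by
  induction a with
  | zero => exact ⟨i, by omega, by omega, Nat.mod_eq_of_lt hi⟩
  | succ a ih =>
    obtain ⟨j, h1, h2, h3⟩ := ih
    rcases h1.eq_or_lt with rfl | h
    · exact ⟨a + d, by omega, by omega, by simpa using h3⟩
    · exact ⟨j, h, by omega, h3⟩

/-! ### Level allocations -/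

variable {T : ℕ} {p : ℝ}

/-- Weak interference, all levels in use, interference treated as noise. -/
lemma mem_capacityRegion_noise_of_le {nd nc : ℕ} (hT : 1 ≤ T) (hp0 : 0 ≤ p) (hp1 : p ≤ 1)
    (hle : nc ≤ nd) :
    (((nd - nc : ℕ) : ℝ) + (1 - p) * nc, ((nd - nc : ℕ) : ℝ) + (1 - p) * nc)
      ∈ capacityRegion nd nc T p := by
  let F : (Fin (nd - nc) → Fin T → ZMod 2) × (Fin nc → Fin T → ZMod 2) → ℕ → Fin T → ZMod 2 :=
    fun x j => if j < nd - nc then entry x.1 j else entry x.2 (j - (nd - nc))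
  have hF : ∀ x j, F x j = if j < nd - nc then entry x.1 j else entry x.2 (j - (nd - nc)) :=
    fun _ _ => rfl
  have h : Resolves nd nc (fun x => ofLevels _ (F x)) (fun x => ofLevels _ (F x)) := by
    have hfst : ∀ x x', (∀ j < nd - nc, F x j = F x' j) → x.1 = x'.1 := fun x x' h =>
      ext_entry fun j hj => by simpa [hF, hj] using h j hj
    refine resolves_of_le hle (fun x x' h => Prod.ext (hfst _ _ fun j hj => h j (by omega)) ?_)
      fun x x' y y' h _ => hfst _ _ h
    refine ext_entry fun j hj => ?_
    simpa [hF] using h (j + (nd - nc)) (by omega)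
  exact mem_capacityRegion_of_resolves hT hp0 hp1 h h

/-- Strong interference treated as noise. -/
lemma mem_capacityRegion_noise_of_lt {nd nc : ℕ} (hT : 1 ≤ T) (hp0 : 0 ≤ p) (hp1 : p ≤ 1)
    (hlt : nd < nc) (hα : nc ≤ 2 * nd) :
    (((nc - nd : ℕ) : ℝ) + (1 - p) * ((2 * nd - nc : ℕ) : ℝ),
      ((nc - nd : ℕ) : ℝ) + (1 - p) * ((2 * nd - nc : ℕ) : ℝ)) ∈ capacityRegion nd nc T p := by
  let F : (Fin (nc - nd) → Fin T → ZMod 2) × (Fin (2 * nd - nc) → Fin T → ZMod 2) →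
      ℕ → Fin T → ZMod 2 :=
    fun x j => if j < 2 * nd - nc then entry x.2 j else entry x.1 (j - (2 * nd - nc))
  have hF : ∀ x j, F x j =
      if j < 2 * nd - nc then entry x.2 j else entry x.1 (j - (2 * nd - nc)) :=
    fun _ _ => rfl
  have hF0 : ∀ x j, nd ≤ j → F x j = 0 := fun x j hj => by
    rw [hF, if_neg (by omega), entry_of_le _ (by omega)]
  have h : Resolves nd nc (fun x => ofLevels _ (F x)) (fun x => ofLevels _ (F x)) := by
    have hfst : ∀ x x', (∀ j < nd, 2 * nd - nc ≤ j → F x j = F x' j) → x.1 = x'.1 :=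
      fun x x' h => ext_entry fun j hj => by
        simpa [hF] using h (j + (2 * nd - nc)) (by omega) (by omega)
    refine resolves_of_lt hlt (fun x x' h => Prod.ext (hfst _ _ fun j hj _ => h j hj) ?_)
      fun x x' y y' _ h => hfst _ _ fun j hj hj' => ?_
    · refine ext_entry fun j hj => ?_
      simpa [hF, hj] using h j (by omega)
    -- Own level `j` meets level `j + (nc - nd)` of the interferer, which is silent from `nd` on;
    -- thus levels `j ≥ 2 * nd - nc` are clean.
    · simpa [hF0 _ (j + (nc - nd)) (by omega)] using h j hj
  exact mem_capacityRegion_of_resolves hT hp0 hp1 h h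

/-- Moderate interference treated as noise, with the middle levels left empty. -/
lemma mem_capacityRegion_noise_middle {nd nc : ℕ} (hT : 1 ≤ T) (hp0 : 0 ≤ p) (hp1 : p ≤ 1)
    (h₁ : nd ≤ 2 * nc) (h₂ : 3 * nc ≤ 2 * nd) :
    ((nc : ℝ) + (1 - p) * ((2 * nd - 3 * nc : ℕ) : ℝ),
      (nc : ℝ) + (1 - p) * ((2 * nd - 3 * nc : ℕ) : ℝ)) ∈ capacityRegion nd nc T p := by
  obtain ⟨d, hd⟩ : ∃ d, d = nd - nc := ⟨_, rfl⟩
  let F : (Fin nc → Fin T → ZMod 2) × (Fin (2 * nd - 3 * nc) → Fin T → ZMod 2) →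
      ℕ → Fin T → ZMod 2 :=
    fun x j => if j < d then entry x.1 j else if j < nc then 0 else
      if j < 2 * d then entry x.2 (j - nc) else entry x.1 (j - d)
  have hF : ∀ x j, F x j = if j < d then entry x.1 j else if j < nc then 0 else
      if j < 2 * d then entry x.2 (j - nc) else entry x.1 (j - d) := fun _ _ => rfl
  have h : Resolves nd nc (fun x => ofLevels _ (F x)) (fun x => ofLevels _ (F x)) := by
    have hfst : ∀ x x', (∀ j < d, F x j = F x' j) →
        (∀ j < nc, d ≤ j → F x (j + d) = F x' (j + d)) → x.1 = x'.1 := by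
      refine fun x x' ha hb => ext_entry fun j hj => ?_
      rcases lt_or_ge j d with hjd | hjd
      · simpa [hF, hjd] using ha j hjd
      · have := hb j hj hjd
        simp only [hF] at this
        rwa [if_neg (by omega), if_neg (by omega), if_neg (by omega), if_neg (by omega),
          if_neg (by omega), if_neg (by omega), Nat.add_sub_cancel] at this
    refine resolves_of_le (by omega)
      (fun x x' h => Prod.ext (hfst _ _ (fun j hj => h j (by omega))
        fun j hj _ => h _ (by omega)) ?_)
      fun x x' y y' ha hb => hfst _ _ (by rwa [hd]) fun j hj hjd => ?_
    · refine ext_entry fun j hj => ?_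
      have := h (j + nc) (by omega)
      simp only [hF] at this
      rwa [if_neg (by omega), if_neg (by omega), if_pos (by omega), if_neg (by omega),
        if_neg (by omega), if_pos (by omega), Nat.add_sub_cancel] at this
    -- The empty band `[d, nc)` of the interferer falls on rows `[2 * d, nd)`, which hold the rest
    -- of the protected symbols.
    · have hz : ∀ y, F y j = 0 := fun y => by rw [hF, if_neg (by omega), if_pos hj]
      have := hb j hj
      rwa [hz, hz, add_zero, add_zero, ← hd] at this
  exact mem_capacityRegion_of_resolves hT hp0 hp1 h h

/-- Strong interference: one user sends on all levels, the other repeats its symbols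
periodically. -/
lemma mem_capacityRegion_periodic_of_lt {nd nc : ℕ} (hT : 1 ≤ T) (hp0 : 0 ≤ p) (hp1 : p ≤ 1)
    (hlt : nd < nc) (hα : nc ≤ 2 * nd) :
    ((nd : ℝ), ((nc - nd : ℕ) : ℝ)) ∈ capacityRegion nd nc T p := by
  obtain ⟨d, hd⟩ : ∃ d, d = nc - nd := ⟨_, rfl⟩
  rw [← hd]
  let F : (Fin nd → Fin T → ZMod 2) × (Fin 0 → Fin T → ZMod 2) → ℕ → Fin T → ZMod 2 :=
    fun x j => entry x.1 j
  let G : (Fin d → Fin T → ZMod 2) × (Fin 0 → Fin T → ZMod 2) → ℕ → Fin T → ZMod 2 :=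
    fun y j => if j < nd then entry y.1 (j % d) else 0
  have hG : ∀ y j, G y j = if j < nd then entry y.1 (j % d) else 0 := fun _ _ => rfl
  have hGext : ∀ (a : ℕ) (y y'), a + d ≤ nd → (∀ j, a ≤ j → j < a + d → G y j = G y' j) →
      y = y' := by
    refine fun a y y' ha h => Prod.ext (ext_entry fun i hi => ?_) (Subsingleton.elim _ _)
    obtain ⟨j, h1, h2, rfl⟩ := exists_mod_eq_of_window hi a
    simpa [hG, show j < nd by omega] using h j h1 h2
  have hFext : ∀ x x', (∀ j < nd, F x j = F x' j) → x = x' := fun x x' h =>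
    Prod.ext (ext_entry h) (Subsingleton.elim _ _)
  have h₁ : Resolves nd nc (fun x => ofLevels _ (F x)) (fun y => ofLevels _ (G y)) := by
    refine resolves_of_lt hlt hFext fun x x' y y' ha hb => ?_
    -- The top `d` rows show a full period of the interferer, hence its whole signal, which is then
    -- cancelled.
    obtain rfl := hGext 0 y y' (by omega) fun j _ hj => ha j (by omega)
    exact congrArg _ (hFext x x' fun j hj => add_right_cancel (hb j hj))
  have h₂ : Resolves nd nc (fun y => ofLevels _ (G y)) (fun x => ofLevels _ (F x)) := by
    refine resolves_of_lt hlt (fun y y' h => hGext 0 y y' (by omega) fun j _ hj => h j (by omega))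
      fun y y' x x' _ hb => congrArg _ (hGext (nd - d) y y' (by omega) fun j hj hj' => ?_)
    -- The last `d` own levels meet only silent levels of the other user and contain a full period.
    have hz : ∀ x, F x (j + (nc - nd)) = 0 := fun x => entry_of_le _ (by omega)
    simpa [hz] using hb j (by omega)
  simpa using mem_capacityRegion_of_resolves hT hp0 hp1 h₁ h₂

/-- Weak interference with `3 nc ≥ 2 nd`: both users leave a gap in the middle, and one of them
repeats its symbols periodically above it. -/
lemma mem_capacityRegion_periodic_of_le {nd nc : ℕ} (hT : 1 ≤ T) (hp0 : 0 ≤ p) (hp1 : p ≤ 1)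
    (hle : nc ≤ nd) (h₃ : 2 * nd ≤ 3 * nc) :
    ((nc : ℝ), ((2 * (nd - nc) : ℕ) : ℝ)) ∈ capacityRegion nd nc T p := by
  obtain ⟨d, hd⟩ : ∃ d, d = nd - nc := ⟨_, rfl⟩
  rw [← hd]
  let F : (Fin nc → Fin T → ZMod 2) × (Fin 0 → Fin T → ZMod 2) → ℕ → Fin T → ZMod 2 :=
    fun x j => if j < nc - d then entry x.1 j else if j < nc then 0 else entry x.1 (j - d)
  let G : (Fin (2 * d) → Fin T → ZMod 2) × (Fin 0 → Fin T → ZMod 2) → ℕ → Fin T → ZMod 2 :=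
    fun y j => if j < nc - d then entry y.1 (j % d) else if j < nc then 0 else
      entry y.1 (j - nc + d)
  have hF : ∀ x j, F x j = if j < nc - d then entry x.1 j else if j < nc then 0 else
      entry x.1 (j - d) := fun _ _ => rfl
  have hG : ∀ y j, G y j = if j < nc - d then entry y.1 (j % d) else if j < nc then 0 else
      entry y.1 (j - nc + d) := fun _ _ => rfl
  have hFz : ∀ x j, nc - d ≤ j → j < nc → F x j = 0 := fun x j h h' => by
    rw [hF, if_neg (by omega), if_pos h']
  have hGz : ∀ y j, nc - d ≤ j → j < nc → G y j = 0 := fun y j h h' => by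
    rw [hG, if_neg (by omega), if_pos h']
  have hFext : ∀ x x', (∀ j < nd, F x j = F x' j) → x = x' := by
    refine fun x x' h => Prod.ext (ext_entry fun i hi => ?_) (Subsingleton.elim _ _)
    rcases lt_or_ge i (nc - d) with hid | hid
    · simpa [hF, hid] using h i (by omega)
    · have := h (i + d) (by omega)
      simp only [hF] at this
      rwa [if_neg (by omega), if_neg (by omega), if_neg (by omega), if_neg (by omega),
        Nat.add_sub_cancel] at this
  have hGext : ∀ y y', (∀ j < d, G y j = G y' j) →
      (∀ j < nd, nc ≤ j → G y j = G y' j) → y = y' := by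
    refine fun y y' ha hb => Prod.ext (ext_entry fun i hi => ?_) (Subsingleton.elim _ _)
    rcases lt_or_ge i d with hid | hid
    · simpa [hG, show i < nc - d by omega, Nat.mod_eq_of_lt hid] using ha i hid
    · have := hb (i - d + nc) (by omega) (by omega)
      simp only [hG] at this
      rwa [if_neg (by omega), if_neg (by omega), if_neg (by omega), if_neg (by omega),
        Nat.add_sub_cancel, Nat.sub_add_cancel hid] at this
  have h₁ : Resolves nd nc (fun x => ofLevels _ (F x)) (fun y => ofLevels _ (G y)) := by
    refine resolves_of_le hle hFext fun x x' y y' ha hb => congrArg _ (hFext x x' fun j hj => ?_)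
    rw [← hd] at ha hb
    -- The own gap `[nc - d, nc)` receives levels `[nc - 2 * d, nc - d)` of the interferer: a full
    -- period, because `2 * d ≤ nc`.
    have hper : ∀ i < d, entry y.1 i = entry y'.1 i := by
      intro i hi
      obtain ⟨j, h1, h2, rfl⟩ := exists_mod_eq_of_window hi (nc - 2 * d)
      have := hb j (by omega)
      rw [hFz x _ (by omega) (by omega), hFz x' _ (by omega) (by omega), zero_add, zero_add,
        hG, hG, if_pos (by omega), if_pos (by omega)] at this
      exact this
    have hGeq : ∀ i < nc, G y i = G y' i := by
      intro i hi
      rw [hG, hG]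
      split_ifs
      -- For `d = 0` residues are not bounded by `d`, but there are no repeated symbols either.
      · rcases Nat.eq_zero_or_pos d with h0 | h0
        · rw [entry_of_le _ (by omega), entry_of_le _ (by omega)]
        · exact hper _ (Nat.mod_lt _ h0)
      · rfl
    rcases lt_or_ge j d with hjd | hjd
    · exact ha j hjd
    · have := hb (j - d) (by omega)
      rw [hGeq _ (by omega), Nat.sub_add_cancel hjd] at this
      exact add_right_cancel this
  have h₂ : Resolves nd nc (fun y => ofLevels _ (G y)) (fun x => ofLevels _ (F x)) := by
    refine resolves_of_le hle
      (fun y y' h => hGext y y' (fun j _ => h j (by omega)) fun j hj _ => h j hj)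
      fun y y' x x' ha hb => congrArg _ (hGext y y' (by rwa [hd]) fun j hj hj' => ?_)
    -- Rows `[nc, nd)` meet the other user's gap `[nc - d, nc)`, so the non-repeated symbols arrive
    -- clean.
    have := hb (j - d) (by omega)
    rwa [hFz x _ (by omega) (by omega), hFz x' _ (by omega) (by omega), add_zero, add_zero,
      ← hd, Nat.sub_add_cancel (by omega)] at this
  simpa using mem_capacityRegion_of_resolves hT hp0 hp1 h₁ h₂

end BurstyIC

/-! ### Matching the regimes with the formula -/

theorem theorem5 (nd nc T : ℕ) (hT : 1 ≤ T) (hα : nc ≤ 2 * nd)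
    (p : ℝ) (hp0 : 0 ≤ p) (hp1 : p ≤ 1) :
    BurstyIC.SumRateAchievable nd nc T p
      (if p ≤ 1 / 2 then
        2 * (1 - 2 * p) * (nd : ℝ)
          + 2 * p * (max ((nd : ℝ) - (nc : ℝ)) 0 + max (nd : ℝ) (nc : ℝ))
      else
        min (max ((nd : ℝ) - (nc : ℝ)) 0 + max (nd : ℝ) (nc : ℝ))
          (2 * (1 - p) * (max ((nd : ℝ) - (nc : ℝ)) 0 + max (nd : ℝ) (nc : ℝ))
            + 2 * (2 * p - 1) * max (max ((nd : ℝ) - (nc : ℝ)) 0) (nc : ℝ))) := by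
  have hαR : (nc : ℝ) ≤ 2 * nd := by exact_mod_cast hα
  have hc0 : (0 : ℝ) ≤ nc := Nat.cast_nonneg _
  rcases le_or_gt nc nd with hle | hlt
  · have hleR : (nc : ℝ) ≤ nd := by exact_mod_cast hle
    rw [max_eq_left (sub_nonneg.2 hleR), max_eq_left hleR]
    split_ifs with hp
    · refine ⟨_, _, BurstyIC.mem_capacityRegion_noise_of_le hT hp0 hp1 hle, ?_⟩
      rw [Nat.cast_sub hle]
      ring
    · have hp' : 0 ≤ 2 * p - 1 := by linarith
      rcases le_total (2 * nd) (3 * nc) with h₃ | h₃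
      · refine ⟨_, _, BurstyIC.mem_capacityRegion_periodic_of_le hT hp0 hp1 hle h₃, ?_⟩
        have h₃R : 2 * (nd : ℝ) ≤ 3 * nc := by exact_mod_cast h₃
        rw [max_eq_right (by linarith), min_eq_left (by nlinarith), Nat.cast_mul,
          Nat.cast_sub hle]
        push_cast
        ring
      · have h₃R : 3 * (nc : ℝ) ≤ 2 * nd := by exact_mod_cast h₃
        rcases le_total (2 * nc) nd with h₂ | h₂
        · refine ⟨_, _, BurstyIC.mem_capacityRegion_noise_of_le hT hp0 hp1 hle, ?_⟩
          have h₂R : 2 * (nc : ℝ) ≤ nd := by exact_mod_cast h₂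
          rw [max_eq_left (by linarith), min_eq_right (by nlinarith), Nat.cast_sub hle]
          ring
        · refine ⟨_, _, BurstyIC.mem_capacityRegion_noise_middle hT hp0 hp1 h₂ h₃, ?_⟩
          have h₂R : (nd : ℝ) ≤ 2 * nc := by exact_mod_cast h₂
          rw [max_eq_right (by linarith), min_eq_right (by nlinarith), Nat.cast_sub h₃]
          push_cast
          ring
  · have hltR : (nd : ℝ) < nc := by exact_mod_cast hlt
    rw [max_eq_right (sub_nonpos.2 hltR.le), max_eq_right hltR.le, max_eq_right hc0]
    split_ifs with hp
    · refine ⟨_, _, BurstyIC.mem_capacityRegion_noise_of_lt hT hp0 hp1 hlt hα, ?_⟩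
      rw [Nat.cast_sub hlt.le, Nat.cast_sub hα]
      push_cast
      ring
    · refine ⟨_, _, BurstyIC.mem_capacityRegion_periodic_of_lt hT hp0 hp1 hlt hα, ?_⟩
      -- Both `D` and `m` equal `nc` here, so the first term is the minimum.
      rw [min_eq_left (by nlinarith), Nat.cast_sub hlt.le]
      ring
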